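/- **Setting.** Let $M$ be a smooth $n$-dimensional manifold with a smooth Riemannian metric $g$ and Levi-Civita connection $\nabla$, and let $(\phi,\eta,\xi,g)$ be a P-Sasakian structure on $M$: $\phi$ is a smooth $(1,1)$ tensor field, $\eta$ a smooth $1$-form and $\xi$ a smooth vector field with $$\phi^2=I-\eta\otimes\xi,\quad \eta(\xi)=1,\quad \phi\xi=0,\quad \eta\circ\phi=0,\quad g(X,Y)=g(\phi X,\phi Y)+\eta(X)\eta(Y),$$ $$(\nabla_X\phi)Y=-g(X,Y)\xi-\eta(Y)X+2\eta(X)\eta(Y)\xi$$ for all smooth vector fields $X,Y$. Put $\mathcal D=\ker\eta\subset TM$. Let $\pi:TM\to M$ be the projection and, in induced coordinates $(x^i,y^i)$ of $TM$, let $$w^v=w^i\frac{\partial}{\partial y^i},\qquad w^h=w^i\frac{\partial}{\partial x^i}-y^jw^i\Gamma^l_{ij}\frac{\partial}{\partial y^l}$$ be the vertical and horizontal lifts (to a point $u\in TM$) of a tangent vector $w=w^i\frac{\partial}{\partial x^i}$ at $\pi(u)$; for a vector field $X$ on $M$ they give vector fields $X^v,X^h$ on $TM$. Let $\phi^h,\eta^v,\eta^h$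 be the tensor fields on $TM$ with $$\phi^h(X^h)=(\phi X)^h,\ \ \phi^h(X^v)=(\phi X)^v,\quad \eta^v(X^h)=\eta(X)\circ\pi,\ \ \eta^v(X^v)=0,\quad \eta^h(X^h)=0,\ \ \eta^h(X^v)=\eta(X)\circ\pi,$$ and let $\nabla^h$ be the horizontal lift of $\nabla$, the linear connection on $TM$ with $$\nabla^h_{X^h}Y^h=(\nabla_XY)^h,\quad \nabla^h_{X^h}Y^v=(\nabla_XY)^v,\quad \nabla^h_{X^v}Y^h=\nabla^h_{X^v}Y^v=0 .$$ For positive integers $p,q$ let $\sigma_{p,q}=\frac{p+\sqrt{p^2+4q}}2$ and $$F=\frac p2\,I-\frac{2\sigma_{p,q}-p}{2}\left(\phi^h+\eta^h\otimes\xi^h+\eta^v\otimes\xi^v\right).$$ **Theorem.** 1. For every $u\in TM$ and every tangent vector $X\in T_{\pi(u)}M$, at the point $u$, $$(\nabla^h_{X^h}F)\,\xi^h=-\frac{2\sigma_{p,q}-p}{2}\left[(\phi X)^v-(\phi^2X)^h\right].$$ 2. For every $u\in TM$ and every nonzero $X\in\mathcal D_{\pi(u)}$, the vector $(\nabla^h_{X^h}F)\,\xi^h$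 at $u$ is nonzero. 3. If $M$ is nonempty and $n\ge 2$, then $F$ is not parallel with respect to $\nabla^h$; that is, it is not the case that $(\nabla^h_W F)Y=0$ for all smooth vector fields $Y$ on $TM$ and all tangent vectors $W$ of $TM$. -/

import Mathlib

open Bundle
open scoped Manifold ContDiff

noncomputable section

namespace TangentLift

section Lifts

variable {E : Type*} [NormedAddCommGroup E] [NormedSpace ℝ E]
  {H : Type*} [TopologicalSpace H] {I : ModelWithCorners ℝ E H}
  {M : Type*} [TopologicalSpace M] [ChartedSpace H M] [IsManifold I ∞ M]

/-- The differential `dπ_u : T_u(TM) → T_{π(u)}M` of the projection `π : TM → M`. -/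
def dProj (u : TangentBundle I M) : TangentSpace I.tangent u →L[ℝ] TangentSpace I u.proj :=
  mfderiv I.tangent I (TotalSpace.proj : TangentBundle I M → M) u

/-- The vertical lift `w ↦ w^v_u`, from `T_{π(u)}M` to `T_u(TM)`: the differential at `u` of the
inclusion of the fibre through `u` (the fibre `T_{π(u)}M` is, in Mathlib, a copy of the model
vector space `E`).  In induced coordinates, `w^v = w^i ∂/∂y^i`. -/
def vLift (u : TangentBundle I M) : TangentSpace I u.proj →L[ℝ] TangentSpace I.tangent u :=
  mfderiv 𝓘(ℝ, E) I.tangent (fun y : E => (⟨u.proj, y⟩ : TangentBundle I M)) u.snd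

variable (cov : CovariantDerivative I E (TangentSpace I : M → Type _))

/-- The connector (connection map) `K_u : T_u(TM) → T_{π(u)}M` of a linear connection: in the
local frame `e_i` of `TM` given by the trivialization at `π(u)`, with fibre coordinates `y^i`, it is
`K_u(W) = dy^i(W) e_i + y^i(u) ∇_{dπ(W)} e_i`, that is, `K^l = dy^l + y^j Γ^l_{kj} dx^k`.  The field
`FiberBundle.extend E u.snd` is the local field with constant components `y^i(u)`. -/
def connector (u : TangentBundle I M) :
    TangentSpace I.tangent u →L[ℝ] TangentSpace I u.proj :=
  ((trivializationAt E (TangentSpace I : M → Type _) u.proj).symmL ℝ u.proj).comp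
      (mvfderiv I.tangent
        (fun z : TangentBundle I M =>
          ((trivializationAt E (TangentSpace I : M → Type _) u.proj) z).2) u)
    + (cov (FiberBundle.extend E u.snd) u.proj).comp (dProj u)

/-- The horizontal lift `w ↦ w^h_u`, from `T_{π(u)}M` to `T_u(TM)`: if `Y` is a local field with
`Y(π(u)) = u`, then `w^h_u = dY(w) - (∇_w Y)^v_u`.  With `Y` of constant components this is
`w^h = w^i ∂/∂x^i - y^j w^i Γ^l_{ij} ∂/∂y^l`. -/
def hLift (u : TangentBundle I M) : TangentSpace I u.proj →L[ℝ] TangentSpace I.tangent u :=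
  let A : TangentSpace I u.proj →L[ℝ] TangentSpace I.tangent u :=
    mfderiv I I.tangent
      (fun x : M => (⟨x, FiberBundle.extend E u.snd x⟩ : TangentBundle I M)) u.proj
  A - (vLift u).comp (cov (FiberBundle.extend E u.snd) u.proj)

/-- The horizontal lift `X^h` of a vector field `X` on `M`. -/
def hLiftField (X : Π x : M, TangentSpace I x) (u : TangentBundle I M) :
    TangentSpace I.tangent u :=
  hLift cov u (X u.proj)

/-- The vertical lift `X^v` of a vector field `X` on `M`. -/
def vLiftField (X : Π x : M, TangentSpace I x) (u : TangentBundle I M) :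
    TangentSpace I.tangent u :=
  vLift u (X u.proj)

/-- The horizontal lift `φ^h` of a `(1,1)` tensor field: `φ^h(X^h) = (φX)^h`,
`φ^h(X^v) = (φX)^v`. -/
def hLiftEndo (φ : Π x : M, TangentSpace I x →L[ℝ] TangentSpace I x) (u : TangentBundle I M) :
    TangentSpace I.tangent u →L[ℝ] TangentSpace I.tangent u :=
  (hLift cov u).comp ((φ u.proj).comp (dProj u))
    + (vLift u).comp ((φ u.proj).comp (connector cov u))

/-- The vertical lift `η^v = η ∘ dπ` of a 1-form. -/
def vLiftForm (η : Π x : M, TangentSpace I x →L[ℝ] ℝ) (u : TangentBundle I M) :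
    TangentSpace I.tangent u →L[ℝ] ℝ :=
  (η u.proj).comp (dProj u)

/-- The horizontal lift `η^h` of a 1-form: `η^h(X^h) = 0`, `η^h(X^v) = η(X) ∘ π`. -/
def hLiftForm (η : Π x : M, TangentSpace I x →L[ℝ] ℝ) (u : TangentBundle I M) :
    TangentSpace I.tangent u →L[ℝ] ℝ :=
  (η u.proj).comp (connector cov u)

/-- The horizontal lift `∇^h` to `TM` of a linear connection `∇` on `M`; as for Mathlib's
covariant derivatives, `hLiftConnection cov Y u W` is `(∇^h_W Y)_u`.

A field `Y` on `TM` is determined by `dπ(Y)` and `K(Y)`, which are vector fields along `π`, and for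
a vector field `Z` along `π`, regarded as a map `TM → TM`, the pulled back connection is
`∇_W Z = K(dZ(W))`.  The horizontal lift is `∇^h_W Y = (∇_W dπ(Y))^h + (∇_W K(Y))^v`; it is the
linear connection with `∇^h_{X^h} Y^h = (∇_X Y)^h`, `∇^h_{X^h} Y^v = (∇_X Y)^v` and
`∇^h_{X^v} Y^h = ∇^h_{X^v} Y^v = 0`. -/
def hLiftConnection (Y : Π u : TangentBundle I M, TangentSpace I.tangent u)
    (u : TangentBundle I M) : TangentSpace I.tangent u →L[ℝ] TangentSpace I.tangent u :=
  let Z₁ : TangentBundle I M → TangentBundle I M := fun z => ⟨z.proj, dProj z (Y z)⟩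
  let Z₂ : TangentBundle I M → TangentBundle I M := fun z => ⟨z.proj, connector cov z (Y z)⟩
  (hLift cov u).comp ((connector cov (Z₁ u)).comp (mfderiv I.tangent I.tangent Z₁ u))
    + (vLift u).comp ((connector cov (Z₂ u)).comp (mfderiv I.tangent I.tangent Z₂ u))

/-- `((D_W F) Y)_u = (D_W (F Y))_u - F (D_W Y)_u`, the covariant derivative of a `(1,1)` tensor
field `F` on `TM`, for an operator `D` as above. -/
def covDerivEndo
    (D : (Π u : TangentBundle I M, TangentSpace I.tangent u) →
      (Π u : TangentBundle I M, TangentSpace I.tangent u →L[ℝ] TangentSpace I.tangent u))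
    (F : Π u : TangentBundle I M, TangentSpace I.tangent u →L[ℝ] TangentSpace I.tangent u)
    (Y : Π u : TangentBundle I M, TangentSpace I.tangent u)
    (u : TangentBundle I M) (W : TangentSpace I.tangent u) : TangentSpace I.tangent u :=
  D (fun z => F z (Y z)) u W - F u (D Y u W)

/-- `F` is parallel: `(D_W F) Y = 0` for every smooth vector field `Y` on `TM` and every tangent
vector `W` of `TM`. -/
def IsParallelEndo
    (D : (Π u : TangentBundle I M, TangentSpace I.tangent u) →
      (Π u : TangentBundle I M, TangentSpace I.tangent u →L[ℝ] TangentSpace I.tangent u))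
    (F : Π u : TangentBundle I M, TangentSpace I.tangent u →L[ℝ] TangentSpace I.tangent u) :
    Prop :=
  ∀ Y : Π u : TangentBundle I M, TangentSpace I.tangent u,
    ContMDiff I.tangent I.tangent.tangent ∞
      (fun u => (⟨u, Y u⟩ : TangentBundle I.tangent (TangentBundle I M))) →
    ∀ (u : TangentBundle I M) (W : TangentSpace I.tangent u), covDerivEndo D F Y u W = 0

/-- The metallic mean `σ_{p,q} = (p + √(p² + 4q)) / 2`, the positive root of `x² - p x - q`. -/
def metallicMean (p q : ℕ) : ℝ := ((p : ℝ) + Real.sqrt ((p : ℝ) ^ 2 + 4 * (q : ℝ))) / 2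

/-- `F = (p/2) I - ((2σ_{p,q} - p)/2) (φ^h + η^h ⊗ ξ^h + η^v ⊗ ξ^v)`. -/
def metallicStructure (p q : ℕ) (φ : Π x : M, TangentSpace I x →L[ℝ] TangentSpace I x)
    (η : Π x : M, TangentSpace I x →L[ℝ] ℝ) (ξ : Π x : M, TangentSpace I x)
    (u : TangentBundle I M) : TangentSpace I.tangent u →L[ℝ] TangentSpace I.tangent u :=
  ((p : ℝ) / 2) • ContinuousLinearMap.id ℝ (TangentSpace I.tangent u)
    - ((2 * metallicMean p q - (p : ℝ)) / 2) •
      (hLiftEndo cov φ u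
        + (hLiftForm cov η u).smulRight (hLiftField cov ξ u)
        + (vLiftForm η u).smulRight (vLiftField ξ u))

end Lifts

section Structures

variable {E : Type*} [NormedAddCommGroup E] [NormedSpace ℝ E]
  {H : Type*} [TopologicalSpace H] {I : ModelWithCorners ℝ E H}
  {M : Type*} [TopologicalSpace M] [ChartedSpace H M] [IsManifold I ∞ M]

/-- An almost paracontact structure `(φ, η, ξ)`: smooth tensor fields with `φ² = id - η ⊗ ξ`,
`η(ξ) = 1`, `φ ξ = 0`, `η ∘ φ = 0`. -/
structure IsAlmostParacontact (φ : Π x : M, TangentSpace I x →L[ℝ] TangentSpace I x)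
    (η : Π x : M, TangentSpace I x →L[ℝ] ℝ) (ξ : Π x : M, TangentSpace I x) : Prop where
  smooth_endo : ContMDiff I (I.prod 𝓘(ℝ, E →L[ℝ] E)) ∞
    (fun x => TotalSpace.mk' (E →L[ℝ] E)
      (E := fun x : M => TangentSpace I x →L[ℝ] TangentSpace I x) x (φ x))
  smooth_form : ContMDiff I (I.prod 𝓘(ℝ, E →L[ℝ] ℝ)) ∞
    (fun x => TotalSpace.mk' (E →L[ℝ] ℝ)
      (E := fun x : M => TangentSpace I x →L[ℝ] Bundle.Trivial M ℝ x) x (η x))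
  smooth_field : ContMDiff I I.tangent ∞ (fun x => (⟨x, ξ x⟩ : TangentBundle I M))
  endo_sq : ∀ (x : M) (v : TangentSpace I x), φ x (φ x v) = v - η x v • ξ x
  form_field : ∀ x : M, η x (ξ x) = 1
  endo_field : ∀ x : M, φ x (ξ x) = 0
  form_endo : ∀ (x : M) (v : TangentSpace I x), η x (φ x v) = 0

variable [CompleteSpace E] [FiniteDimensional ℝ E]

/-- `cov` is the Levi-Civita connection of the smooth Riemannian metric `g`: the (smooth) linear
connection which is torsion-free and satisfies `X g(Y, Z) = g(∇_X Y, Z) + g(Y, ∇_X Z)`. -/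
structure IsLeviCivita (g : ContMDiffRiemannianMetric I ∞ E (fun x : M => TangentSpace I x))
    (cov : CovariantDerivative I E (TangentSpace I : M → Type _)) : Prop where
  smooth : cov.ContMDiffCovariantDerivative ∞
  torsion_eq_zero : cov.torsion = 0
  metric : ∀ (Y Z : Π x : M, TangentSpace I x) (x : M) (v : TangentSpace I x),
    MDifferentiableAt I I.tangent (fun z => (⟨z, Y z⟩ : TangentBundle I M)) x →
    MDifferentiableAt I I.tangent (fun z => (⟨z, Z z⟩ : TangentBundle I M)) x →
    mvfderiv I (fun z => g.inner z (Y z) (Z z)) x v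
      = g.inner x (cov Y x v) (Z x) + g.inner x (Y x) (cov Z x v)

/-- A P-Sasakian structure `(φ, η, ξ, g)`, where `cov` is the Levi-Civita connection of `g`: an
almost paracontact structure, compatible with `g`, such that
`(∇_X φ) Y = -g(X,Y) ξ - η(Y) X + 2 η(X) η(Y) ξ`. -/
structure IsPSasakian
    (g : ContMDiffRiemannianMetric I ∞ E (fun x : M => TangentSpace I x))
    (cov : CovariantDerivative I E (TangentSpace I : M → Type _))
    (φ : Π x : M, TangentSpace I x →L[ℝ] TangentSpace I x)
    (η : Π x : M, TangentSpace I x →L[ℝ] ℝ) (ξ : Π x : M, TangentSpace I x) : Prop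
    extends IsAlmostParacontact φ η ξ where
  compatible : ∀ (x : M) (v w : TangentSpace I x),
    g.inner x v w = g.inner x (φ x v) (φ x w) + η x v * η x w
  covDeriv_endo : ∀ X Y : Π x : M, TangentSpace I x,
    ContMDiff I I.tangent ∞ (fun x => (⟨x, X x⟩ : TangentBundle I M)) →
    ContMDiff I I.tangent ∞ (fun x => (⟨x, Y x⟩ : TangentBundle I M)) →
    ∀ x : M, cov (fun z => φ z (Y z)) x (X x) - φ x (cov Y x (X x))
      = -(g.inner x (X x) (Y x)) • ξ x - η x (Y x) • X x + (2 * η x (X x) * η x (Y x)) • ξ x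

end Structures

end TangentLift

end

/-! At each point of `TM` the pair (`dProj`, `connector`) separates horizontal from vertical parts:
it sends `X^h` to `(X, 0)` and `X^v` to `(0, X)`. The delicate relation is `K(X^h) = 0`, which rests
on `K(dY(w)) = ∇_w Y` (`connector_mfderiv_section`). Hence `∇^h` differentiates `A^h + B^v`
componentwise (`hLiftConnection_apply`).

Write `c = (2σ - p)/2`. Then `F ξ^h = (p/2) ξ^h - c ξ^v`, while `F (φX)^h = (p/2)(φX)^h - c (φ²X)^h`
because `η ∘ φ = 0`. Together with `∇_X ξ = φX` (`IsPSasakian.cov_field`) this gives the formula. On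
`ker η`, `φ² = I`, so the horizontal part of the result is `cX`, and `c = √(p² + 4q)/2 > 0`. For
non-parallelism the twin formula for `ξ^v` serves, with vertical part `cX`; when `n ≥ 2`, `ker η`
contains a nonzero `X`. -/

namespace TangentLift

/-! ### Lifts, projection and connector -/

section

variable {E : Type*} [NormedAddCommGroup E] [NormedSpace ℝ E]
  {H : Type*} [TopologicalSpace H] {I : ModelWithCorners ℝ E H}
  {M : Type*} [TopologicalSpace M] [ChartedSpace H M]

theorem mvfderiv_congr_of_eventuallyEq {f g : M → E} {x : M} (h : f =ᶠ[nhds x] g) :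
    mvfderiv I f x = mvfderiv I g x := by
  ext w
  exact DFunLike.congr_fun h.mfderiv_eq w

variable [IsManifold I ∞ M]

theorem mdifferentiableAt_fibreInclusion (x : M) (v : E) :
    MDifferentiableAt 𝓘(ℝ, E) I.tangent (fun y : E => (⟨x, y⟩ : TangentBundle I M)) v := by
  rw [mdifferentiableAt_totalSpace]
  refine ⟨mdifferentiableAt_const, ?_⟩
  let t := trivializationAt E (TangentSpace I : M → Type _) x
  have hx : x ∈ t.baseSet := FiberBundle.mem_baseSet_trivializationAt' x
  have h : (fun y : E => (t (⟨x, y⟩ : TangentBundle I M)).2) =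
      (t.continuousLinearMapAt ℝ x : E → E) := by
    funext y
    exact (t.continuousLinearMapAt_apply_of_mem ℝ hx y).symm
  change MDifferentiableAt 𝓘(ℝ, E) 𝓘(ℝ, E) (fun y : E => (t (⟨x, y⟩ : TangentBundle I M)).2) v
  rw [h]
  let L : E →L[ℝ] E := t.continuousLinearMapAt ℝ x
  exact L.mdifferentiableAt

theorem hasMFDerivAt_fibreInclusion (x : M) (v : E) :
    HasMFDerivAt 𝓘(ℝ, E) I.tangent (fun y : E => (⟨x, y⟩ : TangentBundle I M)) v
      (vLift ⟨x, v⟩) :=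
  (mdifferentiableAt_fibreInclusion x v).hasMFDerivAt

/-- The projection is constant along a fibre, so its composite with the fibre inclusion has zero
derivative. -/
theorem dProj_vLift_mk (x : M) (v : E) (w : TangentSpace I x) :
    dProj ⟨x, v⟩ (vLift ⟨x, v⟩ w) = 0 := by
  have h1 : MDifferentiableAt I.tangent I (TotalSpace.proj : TangentBundle I M → M) ⟨x, v⟩ :=
    mdifferentiableAt_proj _
  have h := HasMFDerivAt.comp v h1.hasMFDerivAt (hasMFDerivAt_fibreInclusion (I := I) x v)
  have h2 := hasMFDerivAt_unique h (hasMFDerivAt_const x v)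
  exact DFunLike.congr_fun h2 w

theorem dProj_vLift (u : TangentBundle I M) (w : TangentSpace I u.proj) :
    dProj u (vLift u w) = 0 :=
  dProj_vLift_mk (E := E) u.proj u.snd w

theorem dProj_mfderiv_section {Y : Π x : M, TangentSpace I x} {x : M}
    (hY : MDifferentiableAt I I.tangent (fun z => (⟨z, Y z⟩ : TangentBundle I M)) x)
    (w : TangentSpace I x) :
    dProj (⟨x, Y x⟩ : TangentBundle I M)
      (mfderiv I I.tangent (fun z => (⟨z, Y z⟩ : TangentBundle I M)) x w) = w := by
  have h1 : MDifferentiableAt I.tangent I (TotalSpace.proj : TangentBundle I M → M) ⟨x, Y x⟩ :=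
    mdifferentiableAt_proj _
  have h := mfderiv_comp (x := x) (g := (TotalSpace.proj : TangentBundle I M → M))
    (f := fun z => (⟨z, Y z⟩ : TangentBundle I M)) h1 hY
  have h2 : (TotalSpace.proj : TangentBundle I M → M) ∘
    (fun z => (⟨z, Y z⟩ : TangentBundle I M)) = id := rfl
  rw [h2, mfderiv_id] at h
  exact (DFunLike.congr_fun h w).symm

theorem mdifferentiableAt_extend_snd (u : TangentBundle I M) :
    MDifferentiableAt I I.tangent
      (fun z => (⟨z, FiberBundle.extend E u.snd z⟩ : TangentBundle I M)) u.proj :=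
  FiberBundle.mdifferentiableAt_extend I E u.snd

theorem mk_extend (u : TangentBundle I M) :
    (⟨u.proj, FiberBundle.extend E u.snd u.proj⟩ : TangentBundle I M) = u := by
  rw [FiberBundle.extend_apply_self]

variable (cov : CovariantDerivative I E (TangentSpace I : M → Type _))

theorem dProj_hLift (u : TangentBundle I M) (w : TangentSpace I u.proj) :
    dProj u (hLift cov u w) = w := by
  have h := dProj_mfderiv_section (mdifferentiableAt_extend_snd u) w
  rw [mk_extend u] at h
  have h3 : dProj u (hLift cov u w) = dProj u (mfderiv I I.tangent
      (fun x : M => (⟨x, FiberBundle.extend E u.snd x⟩ : TangentBundle I M)) u.proj w)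
      - dProj u (vLift u (cov (FiberBundle.extend E u.snd) u.proj w)) :=
    (dProj u).map_sub _ _
  rw [h3, dProj_vLift, sub_zero]
  exact h

theorem mdifferentiableAt_trivializationAt_snd (x : M) (v : TangentSpace I x) :
    MDifferentiableAt I.tangent 𝓘(ℝ, E) (fun z : TangentBundle I M =>
      ((trivializationAt E (TangentSpace I : M → Type _) x) z).2) ⟨x, v⟩ :=
  ((mdifferentiableAt_totalSpace (IM := I.tangent) I (id : TangentBundle I M → TangentBundle I M)
    (x₀ := ⟨x, v⟩)).1 mdifferentiableAt_id).2

theorem connector_apply (u : TangentBundle I M) (W : TangentSpace I.tangent u) :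
    connector cov u W =
      (trivializationAt E (TangentSpace I : M → Type _) u.proj).symmL ℝ u.proj
        (mvfderiv I.tangent (fun z : TangentBundle I M =>
          ((trivializationAt E (TangentSpace I : M → Type _) u.proj) z).2) u W)
      + cov (FiberBundle.extend E u.snd) u.proj (dProj u W) := rfl

/-- The Christoffel term vanishes on vertical vectors, and along a fibre the coordinate map is
linear, hence its own derivative; `symmL` inverts it. -/
theorem connector_vLift_mk (x : M) (v : E) (w : TangentSpace I x) :
    connector cov ⟨x, v⟩ (vLift ⟨x, v⟩ w) = w := by
  rw [connector_apply, dProj_vLift, map_zero, add_zero]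
  let t := trivializationAt E (TangentSpace I : M → Type _) x
  have hx : x ∈ t.baseSet := FiberBundle.mem_baseSet_trivializationAt' x
  let L : E →L[ℝ] E := t.continuousLinearMapAt ℝ x
  have h := HasMFDerivAt.comp v
    (mdifferentiableAt_trivializationAt_snd (I := I) x v).hasMFDerivAt
    (hasMFDerivAt_fibreInclusion (I := I) x v)
  have h2 : (fun z : TangentBundle I M => (t z).2) ∘
      (fun y : E => (⟨x, y⟩ : TangentBundle I M)) = (L : E → E) := by
    funext y
    exact (t.continuousLinearMapAt_apply_of_mem ℝ hx y).symm
  have h3 : HasMFDerivAt 𝓘(ℝ, E) 𝓘(ℝ, E) (L : E → E) v L := L.hasMFDerivAt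
  have h4 := hasMFDerivAt_unique (h2 ▸ h) h3
  have h5 : mvfderiv I.tangent (fun z : TangentBundle I M => (t z).2) ⟨x, v⟩ (vLift ⟨x, v⟩ w)
      = t.continuousLinearMapAt ℝ x w := DFunLike.congr_fun h4 w
  change t.symmL ℝ x (mvfderiv I.tangent (fun z : TangentBundle I M => (t z).2) ⟨x, v⟩
    (vLift ⟨x, v⟩ w)) = w
  rw [h5]
  exact t.symmL_continuousLinearMapAt hx w

theorem connector_vLift (u : TangentBundle I M) (w : TangentSpace I u.proj) :
    connector cov u (vLift u w) = w :=
  connector_vLift_mk (E := E) cov u.proj u.snd w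

/-- Both `∇_w` and the flat derivative in the trivialization obey the Leibniz rule, so the
derivative terms of the scalar cancel in the difference. This is the Christoffel tensor: it sees
only the value of `Y` at `x`. -/
theorem tensorialAt_cov_sub_flat (x : M) (w : TangentSpace I x) :
    TensorialAt I E (fun Y : Π x : M, TangentSpace I x => cov Y x w -
      (trivializationAt E (TangentSpace I : M → Type _) x).symmL ℝ x
        (mvfderiv I (fun z =>
          ((trivializationAt E (TangentSpace I : M → Type _) x) ⟨z, Y z⟩).2) x w)) x := by
  set t := trivializationAt E (TangentSpace I : M → Type _) x with ht
  have hx : x ∈ t.baseSet := FiberBundle.mem_baseSet_trivializationAt' x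
  have hlin (z : M) (hz : z ∈ t.baseSet) (v : TangentSpace I z) :
      (t ⟨z, v⟩).2 = t.continuousLinearMapAt ℝ z v :=
    (t.continuousLinearMapAt_apply_of_mem ℝ hz v).symm
  have hnhds := t.open_baseSet.mem_nhds hx
  constructor
  · intro f σ hf hσ
    have hσ' := (mdifferentiableAt_section I σ).1 hσ
    have h1 : (fun z => (t ⟨z, (f • σ) z⟩).2) =ᶠ[nhds x] fun z => f z • (t ⟨z, σ z⟩).2 := by
      filter_upwards [hnhds] with z hz
      rw [hlin z hz, hlin z hz]
      exact map_smul _ _ _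
    have h2 : mvfderiv I (fun z => (t ⟨z, (f • σ) z⟩).2) x w
        = f x • mvfderiv I (fun z => (t ⟨z, σ z⟩).2) x w + mvfderiv I f x w • (t ⟨x, σ x⟩).2 := by
      rw [mvfderiv_congr_of_eventuallyEq h1]
      exact DFunLike.congr_fun (mvfderiv_smul hf hσ') w
    have h3 := DFunLike.congr_fun (cov.isCovariantDerivativeOnUniv.leibniz hσ hf) w
    rw [h2, map_add, map_smul, map_smul, hlin x hx, t.symmL_continuousLinearMapAt hx, h3]
    simp only [add_apply, smul_apply, ContinuousLinearMap.smulRight_apply]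
    module
  · intro σ τ hσ hτ
    have hσ' := (mdifferentiableAt_section I σ).1 hσ
    have hτ' := (mdifferentiableAt_section I τ).1 hτ
    have h1 : (fun z => (t ⟨z, (σ + τ) z⟩).2) =ᶠ[nhds x]
        fun z => (t ⟨z, σ z⟩).2 + (t ⟨z, τ z⟩).2 := by
      filter_upwards [hnhds] with z hz
      rw [hlin z hz, hlin z hz, hlin z hz]
      exact map_add _ _ _
    have h2 : mvfderiv I (fun z => (t ⟨z, (σ + τ) z⟩).2) x w
        = mvfderiv I (fun z => (t ⟨z, σ z⟩).2) x w
          + mvfderiv I (fun z => (t ⟨z, τ z⟩).2) x w := by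
      rw [mvfderiv_congr_of_eventuallyEq h1]
      exact DFunLike.congr_fun (mvfderiv_add hσ' hτ') w
    have h3 := DFunLike.congr_fun (cov.isCovariantDerivativeOnUniv.add hσ hτ) w
    rw [h2, map_add, h3, add_apply]
    abel

end

/-! ### The connector recovers the connection -/

section

variable {E : Type*} [NormedAddCommGroup E] [NormedSpace ℝ E] [FiniteDimensional ℝ E]
  {H : Type*} [TopologicalSpace H] {I : ModelWithCorners ℝ E H}
  {M : Type*} [TopologicalSpace M] [ChartedSpace H M] [IsManifold I ∞ M]
  (cov : CovariantDerivative I E (TangentSpace I : M → Type _))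

/-- `K(dY(w)) = ∇_w Y`. -/
theorem connector_mfderiv_section {Y : Π x : M, TangentSpace I x} {x : M}
    (hY : MDifferentiableAt I I.tangent (fun z => (⟨z, Y z⟩ : TangentBundle I M)) x)
    (w : TangentSpace I x) :
    connector cov (⟨x, Y x⟩ : TangentBundle I M)
      (mfderiv I I.tangent (fun z => (⟨z, Y z⟩ : TangentBundle I M)) x w) = cov Y x w := by
  set t := trivializationAt E (TangentSpace I : M → Type _) x with ht
  have hx : x ∈ t.baseSet := FiberBundle.mem_baseSet_trivializationAt' x
  rw [connector_apply, dProj_mfderiv_section hY]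
  have h := mfderiv_comp (x := x) (g := fun z : TangentBundle I M => (t z).2)
    (f := fun z => (⟨z, Y z⟩ : TangentBundle I M))
    (mdifferentiableAt_trivializationAt_snd x (Y x)) hY
  have h1 : mvfderiv I.tangent (fun z : TangentBundle I M => (t z).2) ⟨x, Y x⟩
      (mfderiv I I.tangent (fun z => (⟨z, Y z⟩ : TangentBundle I M)) x w)
      = mvfderiv I (fun z => (t ⟨z, Y z⟩).2) x w := (DFunLike.congr_fun h w).symm
  -- By tensoriality, `Y` may be compared with the constant-component field through `Y x`, the very
  -- field used in the definition of `connector`.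
  have h2 := (tensorialAt_cov_sub_flat cov x w).pointwise hY
    (FiberBundle.mdifferentiableAt_extend I E (Y x)) (FiberBundle.extend_apply_self E (Y x)).symm
  have h3 : mvfderiv I (fun z => (t ⟨z, FiberBundle.extend E (Y x) z⟩).2) x w = 0 := by
    have h4 : (fun z => (t ⟨z, FiberBundle.extend E (Y x) z⟩).2) =ᶠ[nhds x]
        fun _ => (t ⟨x, Y x⟩).2 := by
      filter_upwards [t.open_baseSet.mem_nhds hx] with z hz
      change (t ⟨z, t.symm z (t ⟨x, Y x⟩).2⟩).2 = _
      rw [t.apply_mk_symm hz]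
    rw [mvfderiv_congr_of_eventuallyEq h4, mvfderiv_const]
    rfl
  simp only [← ht] at h2
  rw [h3, map_zero, sub_zero] at h2
  change t.symmL ℝ x (mvfderiv I.tangent (fun z : TangentBundle I M => (t z).2) ⟨x, Y x⟩
      (mfderiv I I.tangent (fun z => (⟨z, Y z⟩ : TangentBundle I M)) x w))
      + cov (FiberBundle.extend E (Y x)) x w = _
  rw [h1, ← h2]
  abel

/-- The vertical correction in `hLift` is exactly what `K` reads off from the derivative of the
extended section. -/
theorem connector_hLift (u : TangentBundle I M) (w : TangentSpace I u.proj) :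
    connector cov u (hLift cov u w) = 0 := by
  have h := connector_mfderiv_section cov (mdifferentiableAt_extend_snd u) w
  rw [mk_extend u] at h
  have h3 : connector cov u (hLift cov u w) = connector cov u (mfderiv I I.tangent
      (fun x : M => (⟨x, FiberBundle.extend E u.snd x⟩ : TangentBundle I M)) u.proj w)
      - connector cov u (vLift u (cov (FiberBundle.extend E u.snd) u.proj w)) :=
    (connector cov u).map_sub _ _
  rw [h3, connector_vLift]
  exact sub_eq_zero.2 h

end

/-- Here `2σ - p` is just `√(p² + 4q)`. -/
theorem half_two_mul_metallicMean_sub_pos (p q : ℕ) (hq : 0 < q) :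
    0 < (2 * metallicMean p q - (p : ℝ)) / 2 := by
  have hq' : (0 : ℝ) < q := Nat.cast_pos.2 hq
  have : 0 < Real.sqrt ((p : ℝ) ^ 2 + 4 * q) := Real.sqrt_pos.2 (by positivity)
  unfold metallicMean
  linarith

/-! ### Smoothness of vertical lifts, and extension of tangent vectors -/

section

variable {E : Type*} [NormedAddCommGroup E] [NormedSpace ℝ E]
  {H : Type*} [TopologicalSpace H] {I : ModelWithCorners ℝ E H}
  {M : Type*} [TopologicalSpace M] [ChartedSpace H M]

/-- The flow `(t, u) ↦ u + t X(π(u))` of the vertical lift of `X`. -/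
noncomputable def vLiftFlow (X : Π x : M, TangentSpace I x) (q : ℝ × TangentBundle I M) :
    TangentBundle I M :=
  ⟨q.2.proj, q.2.snd + q.1 • X q.2.proj⟩

theorem vLiftFlow_zero (X : Π x : M, TangentSpace I x) (u : TangentBundle I M) :
    vLiftFlow X (0, u) = u := by
  simp [vLiftFlow]

variable [IsManifold I ∞ M]

theorem contMDiffAt_add_smul_tangent {E' : Type*} [NormedAddCommGroup E'] [NormedSpace ℝ E']
    {H' : Type*} [TopologicalSpace H'] {J : ModelWithCorners ℝ E' H'}
    {N : Type*} [TopologicalSpace N] [ChartedSpace H' N]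
    {f : N → M} {Y Z : Π z : N, TangentSpace I (f z)} {a : N → ℝ} {z : N}
    (hY : ContMDiffAt J I.tangent ∞ (fun z => (⟨f z, Y z⟩ : TangentBundle I M)) z)
    (hZ : ContMDiffAt J I.tangent ∞ (fun z => (⟨f z, Z z⟩ : TangentBundle I M)) z)
    (ha : ContMDiffAt J 𝓘(ℝ, ℝ) ∞ a z) :
    ContMDiffAt J I.tangent ∞ (fun z => (⟨f z, Y z + a z • Z z⟩ : TangentBundle I M)) z := by
  let t := trivializationAt E (TangentSpace I : M → Type _) (f z)
  have hz : f z ∈ t.baseSet := FiberBundle.mem_baseSet_trivializationAt' (f z)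
  obtain ⟨hf, hY'⟩ := contMDiffAt_totalSpace.1 hY
  obtain ⟨-, hZ'⟩ := contMDiffAt_totalSpace.1 hZ
  refine contMDiffAt_totalSpace.2 ⟨hf, ?_⟩
  refine (hY'.add (ha.smul hZ')).congr_of_eventuallyEq ?_
  filter_upwards [hf.continuousAt.preimage_mem_nhds (t.open_baseSet.mem_nhds hz)] with q hq
  have hq' : f q ∈ t.baseSet := hq
  change (t ⟨f q, Y q + a q • Z q⟩).2 = (t ⟨f q, Y q⟩).2 + a q • (t ⟨f q, Z q⟩).2
  rw [← t.continuousLinearMapAt_apply_of_mem ℝ hq', ← t.continuousLinearMapAt_apply_of_mem ℝ hq',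
    ← t.continuousLinearMapAt_apply_of_mem ℝ hq', map_add, map_smul]

theorem contMDiff_vLiftFlow {X : Π x : M, TangentSpace I x}
    (hX : ContMDiff I I.tangent ∞ (fun x => (⟨x, X x⟩ : TangentBundle I M))) :
    ContMDiff (𝓘(ℝ, ℝ).prod I.tangent) I.tangent ∞ (vLiftFlow X) := by
  intro q
  have hp : ContMDiff (𝓘(ℝ, ℝ).prod I.tangent) I ∞
      (fun q : ℝ × TangentBundle I M => q.2.proj) :=
    (contMDiff_proj _).comp contMDiff_snd
  have h1 : ContMDiff (𝓘(ℝ, ℝ).prod I.tangent) I.tangent ∞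
      (fun q : ℝ × TangentBundle I M => q.2) := contMDiff_snd
  have h2 : ContMDiff (𝓘(ℝ, ℝ).prod I.tangent) I.tangent ∞
      (fun q : ℝ × TangentBundle I M => (⟨q.2.proj, X q.2.proj⟩ : TangentBundle I M)) :=
    hX.comp hp
  exact contMDiffAt_add_smul_tangent (h1 q) (h2 q) contMDiffAt_fst

theorem hasMFDerivAt_vLiftFlow_left (X : Π x : M, TangentSpace I x) (x : M) (v : E) :
    HasMFDerivAt 𝓘(ℝ, ℝ) I.tangent (fun r : ℝ => vLiftFlow X (r, ⟨x, v⟩)) 0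
      ((vLift (vLiftFlow X (0, ⟨x, v⟩))).comp
        (ContinuousLinearMap.toSpanSingleton ℝ (X x))) := by
  let e : E := X x
  let L : ℝ →L[ℝ] E := ContinuousLinearMap.toSpanSingleton ℝ e
  have h1 : HasFDerivAt (fun r : ℝ => v + r • e) L 0 := L.hasFDerivAt.const_add v
  have h2 : HasMFDerivAt 𝓘(ℝ, ℝ) 𝓘(ℝ, E) (fun r : ℝ => v + r • e) 0 L := h1.hasMFDerivAt
  exact HasMFDerivAt.comp (0 : ℝ)
    (hasMFDerivAt_fibreInclusion (I := I) x (v + (0 : ℝ) • e)) h2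

/-- `X^v` is the time-zero velocity of the smooth map `vLiftFlow`, so it is the tangent map of that
flow composed with the smooth section `u ↦ (∂_t, 0)` at `(0, u)`. No coordinates on the double
tangent bundle are needed. -/
theorem contMDiff_vLiftField {X : Π x : M, TangentSpace I x}
    (hX : ContMDiff I I.tangent ∞ (fun x => (⟨x, X x⟩ : TangentBundle I M))) :
    ContMDiff I.tangent I.tangent.tangent ∞
      (fun u => (⟨u, vLiftField X u⟩ : TangentBundle I.tangent (TangentBundle I M))) := by
  have hF := contMDiff_vLiftFlow hX
  have hs : ContMDiff I.tangent (𝓘(ℝ, ℝ).prod I.tangent).tangent ∞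
      (fun u : TangentBundle I M => (equivTangentBundleProd 𝓘(ℝ, ℝ) ℝ I.tangent
        (TangentBundle I M)).symm (⟨0, (1 : ℝ)⟩, ⟨u, 0⟩)) := 
    contMDiff_equivTangentBundleProd_symm.comp
      (contMDiff_const.prodMk (contMDiff_zeroSection ℝ _))
  have hT := (hF.contMDiff_tangentMap (m := ∞) le_rfl).comp hs
  convert hT using 1
  funext u
  have h1 := HasMFDerivAt.comp (0 : ℝ)
    ((hF.mdifferentiableAt (x := ((0 : ℝ), u)) (by simp)).hasMFDerivAt)
    (((hasMFDerivAt_id (0 : ℝ)).prodMk (hasMFDerivAt_const u (0 : ℝ)) :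
      HasMFDerivAt 𝓘(ℝ, ℝ) (𝓘(ℝ, ℝ).prod I.tangent) (fun r : ℝ => (r, u)) 0 _))
  have h2 := DFunLike.congr_fun
    (hasMFDerivAt_unique h1 (hasMFDerivAt_vLiftFlow_left (E := E) X u.proj u.snd)) (1 : ℝ)
  have h3 : mfderiv (𝓘(ℝ, ℝ).prod I.tangent) I.tangent (vLiftFlow X) ((0 : ℝ), u)
      ((1 : ℝ), (0 : TangentSpace I.tangent u)) = vLiftField X (vLiftFlow X (0, u)) := by
    refine h2.trans ?_
    change vLift (vLiftFlow X (0, u)) ((1 : ℝ) • X u.proj) = _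
    rw [one_smul]
    rfl
  calc (⟨u, vLiftField X u⟩ : TangentBundle I.tangent (TangentBundle I M))
      = ⟨vLiftFlow X (0, u), vLiftField X (vLiftFlow X (0, u))⟩ := by rw [vLiftFlow_zero]
    _ = _ := by
      rw [← h3]
      rfl

theorem metallicStructure_vLift
    (cov : CovariantDerivative I E (TangentSpace I : M → Type _)) (p q : ℕ)
    (φ : Π x : M, TangentSpace I x →L[ℝ] TangentSpace I x)
    (η : Π x : M, TangentSpace I x →L[ℝ] ℝ) (ξ : Π x : M, TangentSpace I x)
    (u : TangentBundle I M) (w : TangentSpace I u.proj) :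
    metallicStructure cov p q φ η ξ u (vLift u w) = ((p : ℝ) / 2) • vLift u w
      - ((2 * metallicMean p q - (p : ℝ)) / 2) •
        (vLift u (φ u.proj w) + η u.proj w • hLift cov u (ξ u.proj)) := by
  simp [metallicStructure, hLiftEndo, hLiftForm, vLiftForm, dProj_vLift, connector_vLift,
    hLiftField, vLiftField]

/-- Every tangent vector extends to a smooth vector field. -/
theorem exists_contMDiff_field [FiniteDimensional ℝ E] [T2Space M] (x : M) (v : TangentSpace I x) :
    ∃ X : Π x : M, TangentSpace I x,
      ContMDiff I I.tangent ∞ (fun z => (⟨z, X z⟩ : TangentBundle I M)) ∧ X x = v := by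
  obtain ⟨s, hs, hsm⟩ := FiberBundle.exists_contMDiffOn_extend (k := ∞) I E v
  obtain ⟨U, hUs, hU, hxU⟩ := mem_nhds_iff.1 hs
  -- The bump function is supported where the local extension is smooth and equals 1 at `x`, so the
  -- product is globally smooth with the right value.
  obtain ⟨ψ, -, hψ⟩ := (SmoothBumpFunction.nhds_basis_tsupport (I := I) x).mem_iff.1
    (hU.mem_nhds hxU)
  refine ⟨(ψ : M → ℝ) • FiberBundle.extend E v,
    ContMDiffOn.smul_section_of_tsupport ψ.contMDiff.contMDiffOn hU hψ (hsm.mono hUs), ?_⟩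
  simp

end

/-! ### The lifted connection on fields `A^h + B^v` -/

section

variable {E : Type*} [NormedAddCommGroup E] [NormedSpace ℝ E] [FiniteDimensional ℝ E]
  {H : Type*} [TopologicalSpace H] {I : ModelWithCorners ℝ E H}
  {M : Type*} [TopologicalSpace M] [ChartedSpace H M] [IsManifold I ∞ M]
  (cov : CovariantDerivative I E (TangentSpace I : M → Type _))

theorem connector_mfderiv_section_comp_proj {A : Π x : M, TangentSpace I x} (u : TangentBundle I M)
    (hA : MDifferentiableAt I I.tangent (fun z => (⟨z, A z⟩ : TangentBundle I M)) u.proj)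
    (W : TangentSpace I.tangent u) :
    connector cov (⟨u.proj, A u.proj⟩ : TangentBundle I M)
      (mfderiv I.tangent I.tangent
        (fun z : TangentBundle I M => (⟨z.proj, A z.proj⟩ : TangentBundle I M)) u W)
      = cov A u.proj (dProj u W) := by
  rw [← connector_mfderiv_section cov hA]
  have h1 : MDifferentiableAt I.tangent I (TotalSpace.proj : TangentBundle I M → M) u :=
    mdifferentiableAt_proj _
  have h := mfderiv_comp (x := u) (g := fun z => (⟨z, A z⟩ : TangentBundle I M))
    (f := (TotalSpace.proj : TangentBundle I M → M)) hA h1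
  exact congrArg _ (DFunLike.congr_fun h W)

/-- `∇^h_W (A^h + B^v) = (∇_{dπ(W)} A)^h + (∇_{dπ(W)} B)^v`. -/
theorem hLiftConnection_apply {A B : Π x : M, TangentSpace I x}
    {Y : Π u : TangentBundle I M, TangentSpace I.tangent u}
    (hYA : ∀ z, dProj z (Y z) = A z.proj) (hYB : ∀ z, connector cov z (Y z) = B z.proj)
    (u : TangentBundle I M)
    (hA : MDifferentiableAt I I.tangent (fun z => (⟨z, A z⟩ : TangentBundle I M)) u.proj)
    (hB : MDifferentiableAt I I.tangent (fun z => (⟨z, B z⟩ : TangentBundle I M)) u.proj)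
    (W : TangentSpace I.tangent u) :
    hLiftConnection cov Y u W = hLift cov u (cov A u.proj (dProj u W))
      + vLift u (cov B u.proj (dProj u W)) := by
  have h1 : (fun z : TangentBundle I M => (⟨z.proj, dProj z (Y z)⟩ : TangentBundle I M))
      = fun z => ⟨z.proj, A z.proj⟩ := funext fun z => by rw [hYA]
  have h2 : (fun z : TangentBundle I M => (⟨z.proj, connector cov z (Y z)⟩ : TangentBundle I M))
      = fun z => ⟨z.proj, B z.proj⟩ := funext fun z => by rw [hYB]
  -- The fibre over `(Z u).proj` depends on `Z`; stating the equality in the common model space `E`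
  -- avoids transport.
  have key {Z Z' : TangentBundle I M → TangentBundle I M} (h : Z = Z') :
      (connector cov (Z u) (mfderiv I.tangent I.tangent Z u W) : E)
        = connector cov (Z' u) (mfderiv I.tangent I.tangent Z' u W) := by
    rw [h]
  rw [← connector_mfderiv_section_comp_proj cov u hA,
    ← connector_mfderiv_section_comp_proj cov u hB]
  exact congrArg₂ (· + ·) (congrArg (hLift cov u) (key h1)) (congrArg (vLift u) (key h2))

variable (p q : ℕ) (φ : Π x : M, TangentSpace I x →L[ℝ] TangentSpace I x)
    (η : Π x : M, TangentSpace I x →L[ℝ] ℝ) (ξ : Π x : M, TangentSpace I x)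

theorem metallicStructure_hLift (u : TangentBundle I M) (w : TangentSpace I u.proj) :
    metallicStructure cov p q φ η ξ u (hLift cov u w) = ((p : ℝ) / 2) • hLift cov u w
      - ((2 * metallicMean p q - (p : ℝ)) / 2) •
        (hLift cov u (φ u.proj w) + η u.proj w • vLift u (ξ u.proj)) := by
  simp [metallicStructure, hLiftEndo, hLiftForm, vLiftForm, dProj_hLift, connector_hLift,
    hLiftField, vLiftField]

end

/-! ### P-Sasakian identities and the derivative of `F` -/

section

variable {E : Type*} [NormedAddCommGroup E] [NormedSpace ℝ E]
  {H : Type*} [TopologicalSpace H] {I : ModelWithCorners ℝ E H}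
  {M : Type*} [TopologicalSpace M] [ChartedSpace H M] [IsManifold I ∞ M]
  {g : ContMDiffRiemannianMetric I ∞ E (fun x : M => TangentSpace I x)}
  {cov : CovariantDerivative I E (TangentSpace I : M → Type _)}
  {φ : Π x : M, TangentSpace I x →L[ℝ] TangentSpace I x}
  {η : Π x : M, TangentSpace I x →L[ℝ] ℝ} {ξ : Π x : M, TangentSpace I x}

theorem IsPSasakian.inner_field (hP : IsPSasakian g cov φ η ξ) (x : M) (v : TangentSpace I x) :
    g.inner x v (ξ x) = η x v := by
  rw [hP.compatible, hP.endo_field, hP.form_field, map_zero, zero_add, mul_one]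

theorem cov_smul_field (hξ : ContMDiff I I.tangent ∞ (fun x => (⟨x, ξ x⟩ : TangentBundle I M)))
    (r : ℝ) (x : M) (v : TangentSpace I x) : cov (r • ξ) x v = r • cov ξ x v :=
  DFunLike.congr_fun (cov.isCovariantDerivativeOnUniv.smul_const r
    (hξ.mdifferentiableAt (x := x) (by simp))) v

theorem mdifferentiableAt_smul_field
    (hξ : ContMDiff I I.tangent ∞ (fun x => (⟨x, ξ x⟩ : TangentBundle I M))) (r : ℝ) (x : M) :
    MDifferentiableAt I I.tangent (fun z => (⟨z, (r • ξ) z⟩ : TangentBundle I M)) x :=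
  (hξ.mdifferentiableAt (x := x) (by simp)).smul_const_section

/-- On `ker η`, `φ² = id`. -/
theorem IsPSasakian.endo_endo_of_form_eq_zero (hP : IsPSasakian g cov φ η ξ) {x : M}
    {v : TangentSpace I x} (hv : η x v = 0) : φ x (φ x v) = v := by
  rw [hP.endo_sq, hv, zero_smul, sub_zero]

variable [FiniteDimensional ℝ E] [CompleteSpace E]

/-- Differentiate `g(ξ, ξ) = 1` and use `g(·, ξ) = η`. -/
theorem IsPSasakian.form_cov_field (hcov : IsLeviCivita g cov) (hP : IsPSasakian g cov φ η ξ)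
    (x : M) (v : TangentSpace I x) : η x (cov ξ x v) = 0 := by
  have hξ := hP.smooth_field.mdifferentiableAt (x := x) (by simp)
  have h := hcov.metric ξ ξ x v hξ hξ
  have h1 : (fun z => g.inner z (ξ z) (ξ z)) = fun _ => (1 : ℝ) := by
    funext z
    rw [hP.inner_field, hP.form_field]
  rw [h1, mvfderiv_const, g.symm x (ξ x), hP.inner_field] at h
  have h2 : (0 : ℝ) = η x (cov ξ x v) + η x (cov ξ x v) := h
  linarith

/-- On a P-Sasakian manifold, `∇_v ξ = φ v`. -/
theorem IsPSasakian.cov_field [T2Space M] (hcov : IsLeviCivita g cov)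
    (hP : IsPSasakian g cov φ η ξ) (x : M) (v : TangentSpace I x) : cov ξ x v = φ x v := by
  -- The P-Sasakian identity is available only for global smooth fields; it is applied with `Y = ξ`.
  obtain ⟨X, hX, rfl⟩ := exists_contMDiff_field x v
  have h := hP.covDeriv_endo X ξ hX hP.smooth_field x
  have h1 : (fun z => φ z (ξ z)) = 0 := funext fun z => hP.endo_field z
  rw [h1, cov.zero, hP.inner_field, hP.form_field] at h
  have h2 : φ x (cov ξ x (X x)) = X x - η x (X x) • ξ x := by
    have h3 : (0 : TangentSpace I x) - φ x (cov ξ x (X x)) = _ := h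
    rw [← neg_inj, ← zero_sub, h3]
    module
  -- Applying `φ` once more to `φ(∇_X ξ) = X - η(X) ξ` gives `φX`, while `φ²` fixes `∇_X ξ` because
  -- `η(∇_X ξ) = 0`.
  have h4 := hP.endo_sq x (cov ξ x (X x))
  rw [h2, hP.form_cov_field hcov, map_sub, map_smul, hP.endo_field] at h4
  simpa using h4.symm

variable (p q : ℕ)

/-- `(∇^h_{v^h} F) ξ^h`. -/
theorem IsPSasakian.covDerivEndo_hLiftField [T2Space M] (hcov : IsLeviCivita g cov)
    (hP : IsPSasakian g cov φ η ξ) (u : TangentBundle I M) (v : TangentSpace I u.proj) :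
    covDerivEndo (hLiftConnection cov) (metallicStructure cov p q φ η ξ) (hLiftField cov ξ) u
        (hLift cov u v)
      = -((2 * metallicMean p q - (p : ℝ)) / 2) •
          (vLift u (φ u.proj v) - hLift cov u (φ u.proj (φ u.proj v))) := by
  have hξ := hP.smooth_field
  set c := (2 * metallicMean p q - (p : ℝ)) / 2 with hc
  have hF (z : TangentBundle I M) : metallicStructure cov p q φ η ξ z (hLiftField cov ξ z)
      = ((p : ℝ) / 2) • hLift cov z (ξ z.proj) - c • vLift z (ξ z.proj) := by
    rw [hLiftField, metallicStructure_hLift, hP.endo_field, hP.form_field, map_zero, zero_add,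
      one_smul]
  have h1 := hLiftConnection_apply cov (A := ((p : ℝ) / 2) • ξ) (B := (-c) • ξ)
    (Y := fun z => metallicStructure cov p q φ η ξ z (hLiftField cov ξ z))
    (fun z => by simp [hF, dProj_hLift, dProj_vLift])
    (fun z => by simp [hF, connector_hLift, connector_vLift])
    u (mdifferentiableAt_smul_field hξ _ _) (mdifferentiableAt_smul_field hξ _ _) (hLift cov u v)
  -- Writing the components as multiples of `ξ` lets the same scalar lemmas treat both.
  have h2 := hLiftConnection_apply cov (A := (1 : ℝ) • ξ) (B := (0 : ℝ) • ξ)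
    (Y := hLiftField cov ξ)
    (fun z => by simp [hLiftField, dProj_hLift])
    (fun z => by simp [hLiftField, connector_hLift])
    u (mdifferentiableAt_smul_field hξ _ _) (mdifferentiableAt_smul_field hξ _ _) (hLift cov u v)
  rw [dProj_hLift, cov_smul_field hξ, cov_smul_field hξ, hP.cov_field hcov, map_smul, map_smul]
    at h1
  rw [dProj_hLift, cov_smul_field hξ, cov_smul_field hξ, hP.cov_field hcov, one_smul, zero_smul,
    map_zero, add_zero] at h2
  rw [covDerivEndo, h1, h2, metallicStructure_hLift, hP.form_endo, zero_smul, add_zero, ← hc]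
  module

/-- `(∇^h_{v^h} F) ξ^v`. -/
theorem IsPSasakian.covDerivEndo_vLiftField [T2Space M] (hcov : IsLeviCivita g cov)
    (hP : IsPSasakian g cov φ η ξ) (u : TangentBundle I M) (v : TangentSpace I u.proj) :
    covDerivEndo (hLiftConnection cov) (metallicStructure cov p q φ η ξ) (vLiftField ξ) u
        (hLift cov u v)
      = -((2 * metallicMean p q - (p : ℝ)) / 2) •
          (hLift cov u (φ u.proj v) - vLift u (φ u.proj (φ u.proj v))) := by
  have hξ := hP.smooth_field
  set c := (2 * metallicMean p q - (p : ℝ)) / 2 with hc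
  have hF (z : TangentBundle I M) : metallicStructure cov p q φ η ξ z (vLiftField ξ z)
      = ((p : ℝ) / 2) • vLift z (ξ z.proj) - c • hLift cov z (ξ z.proj) := by
    rw [vLiftField, metallicStructure_vLift, hP.endo_field, hP.form_field, map_zero, zero_add,
      one_smul]
  have h1 := hLiftConnection_apply cov (A := (-c) • ξ) (B := ((p : ℝ) / 2) • ξ)
    (Y := fun z => metallicStructure cov p q φ η ξ z (vLiftField ξ z))
    (fun z => by simp [hF, dProj_hLift, dProj_vLift])
    (fun z => by simp [hF, connector_hLift, connector_vLift])
    u (mdifferentiableAt_smul_field hξ _ _) (mdifferentiableAt_smul_field hξ _ _) (hLift cov u v)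
  have h2 := hLiftConnection_apply cov (A := (0 : ℝ) • ξ) (B := (1 : ℝ) • ξ)
    (Y := vLiftField ξ)
    (fun z => by simp [vLiftField, dProj_vLift])
    (fun z => by simp [vLiftField, connector_vLift])
    u (mdifferentiableAt_smul_field hξ _ _) (mdifferentiableAt_smul_field hξ _ _) (hLift cov u v)
  rw [dProj_hLift, cov_smul_field hξ, cov_smul_field hξ, hP.cov_field hcov, map_smul, map_smul]
    at h1
  rw [dProj_hLift, cov_smul_field hξ, cov_smul_field hξ, hP.cov_field hcov, zero_smul, one_smul,
    map_zero, zero_add] at h2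
  rw [covDerivEndo, h1, h2, metallicStructure_vLift, hP.form_endo, zero_smul, add_zero, ← hc]
  module

theorem IsPSasakian.covDerivEndo_hLiftField_ne_zero [T2Space M] (hcov : IsLeviCivita g cov)
    (hP : IsPSasakian g cov φ η ξ) (hq : 0 < q) (u : TangentBundle I M) (v : TangentSpace I u.proj)
    (hv : η u.proj v = 0) (hv0 : v ≠ 0) :
    covDerivEndo (hLiftConnection cov) (metallicStructure cov p q φ η ξ) (hLiftField cov ξ) u
        (hLift cov u v) ≠ 0 := by
  intro h
  rw [hP.covDerivEndo_hLiftField p q hcov, hP.endo_endo_of_form_eq_zero hv] at h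
  -- The horizontal component alone is `c v`.
  have h1 := congrArg (dProj u) h
  rw [map_smul, map_sub, dProj_vLift, dProj_hLift, zero_sub, map_zero, smul_neg, neg_smul, neg_neg]
    at h1
  exact (smul_ne_zero (half_two_mul_metallicMean_sub_pos p q hq).ne' hv0) h1

/-- The test field is `ξ^v` rather than `ξ^h`: its smoothness does not involve the connection. -/
theorem IsPSasakian.not_isParallelEndo [T2Space M] (hcov : IsLeviCivita g cov)
    (hP : IsPSasakian g cov φ η ξ) (hq : 0 < q) (hE : 2 ≤ Module.finrank ℝ E) [Nonempty M] :
    ¬ IsParallelEndo (hLiftConnection cov) (metallicStructure cov p q φ η ξ) := by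
  intro h
  obtain ⟨x⟩ := ‹Nonempty M›
  -- Any point over `x` would do.
  let u : TangentBundle I M := ⟨x, 0⟩
  have hker : ∃ v : TangentSpace I u.proj, η u.proj v = 0 ∧ v ≠ 0 := by
    let L : E →ₗ[ℝ] ℝ := (η x).toLinearMap
    -- Rank-nullity: the range of `η` has dimension at most 1 and `n ≥ 2`.
    have h1 : 0 < Module.finrank ℝ (LinearMap.ker L) := by
      have h2 := L.finrank_range_add_finrank_ker
      have h3 := (LinearMap.range L).finrank_le
      rw [Module.finrank_self] at h3
      omega
    have := Module.finrank_pos_iff.1 h1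
    obtain ⟨v, hv⟩ := exists_ne (0 : LinearMap.ker L)
    exact ⟨v.1, v.2, fun h0 => hv (Subtype.ext h0)⟩
  obtain ⟨v, hv, hv0⟩ := hker
  have h1 := h (vLiftField ξ) (contMDiff_vLiftField hP.smooth_field) u (hLift cov u v)
  rw [hP.covDerivEndo_vLiftField p q hcov] at h1
  have h2 := congrArg (connector cov u) h1
  have h3 : φ u.proj (φ u.proj v) = v := hP.endo_endo_of_form_eq_zero hv
  rw [h3, map_smul, map_sub, connector_vLift, connector_hLift, zero_sub, map_zero, smul_neg,
    neg_smul, neg_neg] at h2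
  exact (smul_ne_zero (half_two_mul_metallicMean_sub_pos p q hq).ne' hv0) h2

end

end TangentLift

theorem mainTheorem5 {n : ℕ} {M : Type*} [TopologicalSpace M] [T2Space M]
    [SecondCountableTopology M] [ChartedSpace (EuclideanSpace ℝ (Fin n)) M]
    [IsManifold (𝓡 n) ∞ M]
    (g : ContMDiffRiemannianMetric (𝓡 n) ∞ (EuclideanSpace ℝ (Fin n))
      (fun x : M => TangentSpace (𝓡 n) x))
    (cov : CovariantDerivative (𝓡 n) (EuclideanSpace ℝ (Fin n))
      (TangentSpace (𝓡 n) : M → Type _))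
    (hcov : TangentLift.IsLeviCivita g cov)
    (φ : Π x : M, TangentSpace (𝓡 n) x →L[ℝ] TangentSpace (𝓡 n) x)
    (η : Π x : M, TangentSpace (𝓡 n) x →L[ℝ] ℝ) (ξ : Π x : M, TangentSpace (𝓡 n) x)
    (hP : TangentLift.IsPSasakian g cov φ η ξ)
    (p q : ℕ) (hp : 0 < p) (hq : 0 < q) :
    (∀ (u : TangentBundle (𝓡 n) M) (v : TangentSpace (𝓡 n) u.proj),
      TangentLift.covDerivEndo (TangentLift.hLiftConnection cov)
          (TangentLift.metallicStructure cov p q φ η ξ) (TangentLift.hLiftField cov ξ) u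
          (TangentLift.hLift cov u v)
        = -((2 * TangentLift.metallicMean p q - (p : ℝ)) / 2) •
            (TangentLift.vLift u (φ u.proj v)
              - TangentLift.hLift cov u (φ u.proj (φ u.proj v)))) ∧
    (∀ (u : TangentBundle (𝓡 n) M) (v : TangentSpace (𝓡 n) u.proj),
      η u.proj v = 0 → v ≠ 0 →
      TangentLift.covDerivEndo (TangentLift.hLiftConnection cov)
          (TangentLift.metallicStructure cov p q φ η ξ) (TangentLift.hLiftField cov ξ) u
          (TangentLift.hLift cov u v) ≠ 0) ∧
    (2 ≤ n → Nonempty M →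
      ¬ TangentLift.IsParallelEndo (TangentLift.hLiftConnection cov)
          (TangentLift.metallicStructure cov p q φ η ξ)) := by
  exact ⟨hP.covDerivEndo_hLiftField p q hcov, hP.covDerivEndo_hLiftField_ne_zero p q hcov hq,
    fun hn _ => hP.not_isParallelEndo p q hcov hq (by simpa using hn)⟩
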